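/- Let $K$ be a field and $m\ge 2$ an integer. Let $\Delta_2^m\subset\mathbb{R}^{m+1}$ be the $(m+1)$-dimensional lattice simplex whose vertices $v_1,\dots,v_{m+2}$ are the standard basis vectors of $\mathbb{R}^{m+1}$ together with the point $(-2,\dots,-2,-2m-1)$. Let $$\Lambda=\Big\{\sum_{i=1}^{m+2}a_i\,(1,v_i)\;:\;a_i\in\mathbb{R}_{\ge 0}\Big\}\cap\mathbb{Z}^{1+(m+1)}$$ be the semigroup of lattice points in the cone over $\Delta_2^m$, let $K[\Lambda]$ be its semigroup algebra with $K$-basis $\{e_z : z\in\Lambda\}$, and let $$\widehat{R}=K[\Lambda]/\big(e_{(1,v_i)} : i=1,\dots,m+2\big)$$ be the fundamental parallelepiped algebra of $\Delta_2^m$, graded by $\mathbb{N}$ so that the class of $e_z$ has degree equal to the zeroth coordinate of $z$. Then $\widehat{R}$ is not Koszul: the residue field $K\cong\widehat{R}/\widehat{R}_{+}$, where $\widehat{R}_{+}=\bigoplus_{n>0}\widehat{R}_n$, has no linear minimal graded free resolution over $\widehat{R}$, that is, no minimal resolution by finitely generated graded free $\widehat{R}$-modules $F_i$ in which every $F_i$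 is generated in degree $i$. -/

import Mathlib

open scoped DirectSum

noncomputable section

/-! ## Minimal graded free resolutions of the residue field, and Koszul algebras -/

section Koszul

variable {K R : Type*} [Field K] [CommRing R] [Algebra K R]

/-- A graded resolution of `R ⧸ R₊` by finitely generated graded free modules over the
`ℕ`-graded `K`-algebra `R = ⨁ₙ 𝒜 n`, where `R₊ = ⨁_{n > 0} 𝒜 n`. If `𝒜 0 = K`, then `R ⧸ R₊` is
the residue field `K`. The `i`-th module `Fᵢ` is free with basis indexed by `Fin (rank i)`, the
basis element `j` being placed in degree `deg i j`, and the differential `F_{i+1} → Fᵢ` is given by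
the matrix `d i`. -/
structure GradedFreeResolution (𝒜 : ℕ → Submodule K R) [GradedAlgebra 𝒜] where
  /-- the rank of `Fᵢ` -/
  rank : ℕ → ℕ
  /-- the degrees of the basis elements of `Fᵢ` -/
  deg : (i : ℕ) → Fin (rank i) → ℕ
  /-- the matrix of the differential `F_{i+1} → Fᵢ` -/
  d : (i : ℕ) → Matrix (Fin (rank i)) (Fin (rank (i + 1))) R
  /-- the augmentation `F₀ → R ⧸ R₊` -/
  aug : (Fin (rank 0) → R) →ₗ[R] R ⧸ (HomogeneousIdeal.irrelevant 𝒜).toIdeal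
  /-- the differentials preserve degrees: the entry in row `j` and column `k` is homogeneous of
  degree `deg (i + 1) k - deg i j` -/
  d_mem : ∀ i j k n, deg (i + 1) k = deg i j + n → d i j k ∈ 𝒜 n
  /-- the entry is zero if that degree is negative -/
  d_eq_zero : ∀ i j k, deg (i + 1) k < deg i j → d i j k = 0
  /-- the augmentation preserves degrees -/
  aug_mem : ∀ j, ∃ r ∈ 𝒜 (deg 0 j), aug (Pi.single j 1) = Ideal.Quotient.mk _ r
  aug_surjective : Function.Surjective aug
  exact_aug : Function.Exact (d 0).mulVecLin aug
  exact_d : ∀ i, Function.Exact (d (i + 1)).mulVecLin (d i).mulVecLin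

variable {𝒜 : ℕ → Submodule K R} [GradedAlgebra 𝒜]

/-- The resolution is minimal: the differentials map `F_{i+1}` into `R₊ Fᵢ`. -/
def GradedFreeResolution.IsMinimal (F : GradedFreeResolution 𝒜) : Prop :=
  ∀ i j k, F.d i j k ∈ HomogeneousIdeal.irrelevant 𝒜

/-- The resolution is linear: `Fᵢ` is generated in degree `i`, i.e. `Fᵢ ≅ R(-i)^{rank i}`. -/
def GradedFreeResolution.IsLinear (F : GradedFreeResolution 𝒜) : Prop :=
  ∀ i j, F.deg i j = i

variable (𝒜) in
/-- A graded algebra is Koszul if its residue field has a linear minimal graded free resolution. -/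
def IsKoszul : Prop :=
  ∃ F : GradedFreeResolution 𝒜, F.IsMinimal ∧ F.IsLinear

end Koszul

/-! ## The fundamental parallelepiped algebra of a lattice simplex

A lattice simplex in `ℝ^d` is given by the family `v` of its `d + 1` vertices. -/

section FPA

variable {d : ℕ}

/-- The cone over the simplex, generated by the vectors `(1, vᵢ)` in `ℝ × ℝ^d`. -/
def coneOver (v : Fin (d + 1) → Fin d → ℤ) : Set (ℝ × (Fin d → ℝ)) :=
  {x | ∃ a : Fin (d + 1) → ℝ, (∀ i, 0 ≤ a i) ∧
    x = ∑ i, a i • ((1 : ℝ), fun j => (v i j : ℝ))}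

/-- The semigroup `Λ = cone(P) ∩ ℤ^{1+d}`. -/
def latticeSemigroup (v : Fin (d + 1) → Fin d → ℤ) : AddSubmonoid (ℤ × (Fin d → ℤ)) where
  carrier := {z | ((z.1 : ℝ), fun j => (z.2 j : ℝ)) ∈ coneOver v}
  zero_mem' := ⟨0, fun _ => le_rfl, by ext <;> simp⟩
  add_mem' := by
    rintro x y ⟨a, ha, hx⟩ ⟨b, hb, hy⟩
    refine ⟨a + b, fun i => add_nonneg (ha i) (hb i), ?_⟩
    simp only [Pi.add_apply, add_smul, Finset.sum_add_distrib, ← hx, ← hy]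
    ext <;> simp

theorem latticeSemigroup_fst_nonneg (v : Fin (d + 1) → Fin d → ℤ) (z : latticeSemigroup v) :
    0 ≤ (z : ℤ × (Fin d → ℤ)).1 := by
  obtain ⟨z, a, ha, h⟩ := z
  have h1 := congrArg Prod.fst h
  simp only [Prod.fst_sum, Prod.smul_fst, smul_eq_mul, mul_one] at h1
  have h2 : (0 : ℝ) ≤ (z.1 : ℝ) := h1 ▸ Finset.sum_nonneg fun i _ => ha i
  exact_mod_cast h2

/-- The degree of a lattice point of the cone: its zeroth coordinate. -/
def height (v : Fin (d + 1) → Fin d → ℤ) : latticeSemigroup v →+ ℕ where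
  toFun z := (z : ℤ × (Fin d → ℤ)).1.toNat
  map_zero' := by simp
  map_add' x y := by
    simpa using Int.toNat_add (latticeSemigroup_fst_nonneg v x) (latticeSemigroup_fst_nonneg v y)

/-- The ray generator `(1, vᵢ)`. -/
def rayGenerator (v : Fin (d + 1) → Fin d → ℤ) (i : Fin (d + 1)) : latticeSemigroup v :=
  ⟨(1, v i), Pi.single i 1, fun j => by by_cases h : j = i <;> simp [h], by
    rw [Finset.sum_eq_single i (fun j _ h => by simp [h]) (by simp)]
    simp⟩

variable (K : Type*) [Field K]

/-- The Ehrhart ring `E(P) = K[Λ]`. -/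
abbrev EhrhartRing (v : Fin (d + 1) → Fin d → ℤ) : Type _ :=
  AddMonoidAlgebra K (latticeSemigroup v)

/-- The ideal of the Ehrhart ring generated by the elements `e_{(1, vᵢ)}`. -/
def rayIdeal (v : Fin (d + 1) → Fin d → ℤ) : Ideal (EhrhartRing K v) :=
  Ideal.span (Set.range fun i => AddMonoidAlgebra.single (rayGenerator v i) (1 : K))

/-- The fundamental parallelepiped algebra `K[Λ] ⧸ (e_{(1, vᵢ)} : i)`. -/
abbrev FPA (v : Fin (d + 1) → Fin d → ℤ) : Type _ :=
  EhrhartRing K v ⧸ rayIdeal K v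

/-- The `ℕ`-grading of the fundamental parallelepiped algebra by height: the degree `n` part is the
image of the span of all `e_z` with `z ∈ Λ` of zeroth coordinate `n`. -/
def fpaGrading (v : Fin (d + 1) → Fin d → ℤ) (n : ℕ) : Submodule K (FPA K v) :=
  (AddMonoidAlgebra.gradeBy K (height v) n).map
    (Ideal.Quotient.mkₐ K (rayIdeal K v)).toLinearMap

/-- The class of the basis element `e_z` in the fundamental parallelepiped algebra. -/
def fpaBasisClass (v : Fin (d + 1) → Fin d → ℤ) (z : latticeSemigroup v) : FPA K v :=
  Ideal.Quotient.mkₐ K (rayIdeal K v) (AddMonoidAlgebra.single z 1)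

theorem fpaBasisClass_mem (v : Fin (d + 1) → Fin d → ℤ) (z : latticeSemigroup v) :
    fpaBasisClass K v z ∈ fpaGrading K v (height v z) :=
  ⟨_, AddMonoidAlgebra.single_mem_gradeBy _ _ _, rfl⟩

instance fpaGrading.gradedMonoid (v : Fin (d + 1) → Fin d → ℤ) :
    SetLike.GradedMonoid (fpaGrading K v) where
  one_mem := ⟨1, SetLike.GradedOne.one_mem, map_one (Ideal.Quotient.mkₐ K (rayIdeal K v))⟩
  mul_mem := by
    rintro i j _ _ ⟨a, ha, rfl⟩ ⟨b, hb, rfl⟩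
    exact ⟨a * b, SetLike.GradedMul.mul_mem ha hb, map_mul (Ideal.Quotient.mkₐ K (rayIdeal K v)) a b⟩

def fpaDecomposeAux (v : Fin (d + 1) → Fin d → ℤ) :
    EhrhartRing K v →ₐ[K] ⨁ n, fpaGrading K v n :=
  AddMonoidAlgebra.lift K _ _
    { toFun := fun z => DirectSum.of (fun n => fpaGrading K v n) (height v z.toAdd)
        ⟨fpaBasisClass K v z.toAdd, fpaBasisClass_mem K v z.toAdd⟩
      map_one' := DirectSum.of_eq_of_gradedMonoid_eq
        (Sigma.subtype_ext (map_zero (height v)) (map_one (Ideal.Quotient.mkₐ K (rayIdeal K v))))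
      map_mul' := fun x y => by
        rw [DirectSum.of_mul_of]
        refine DirectSum.of_eq_of_gradedMonoid_eq
          (Sigma.subtype_ext (map_add (height v) x.toAdd y.toAdd) ?_)
        change fpaBasisClass K v _ = fpaBasisClass K v _ * fpaBasisClass K v _
        simp only [fpaBasisClass, ← map_mul, AddMonoidAlgebra.single_mul_single, mul_one, toAdd_mul] }

theorem fpaDecomposeAux_single (v : Fin (d + 1) → Fin d → ℤ) (z : latticeSemigroup v) (c : K) :
    fpaDecomposeAux K v (AddMonoidAlgebra.single z c) =
      c • DirectSum.of (fun n => fpaGrading K v n) (height v z)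
        ⟨fpaBasisClass K v z, fpaBasisClass_mem K v z⟩ :=
  AddMonoidAlgebra.lift_single _ _ _

theorem fpaDecomposeAux_of_mem (v : Fin (d + 1) → Fin d → ℤ) (n : ℕ) (a : EhrhartRing K v)
    (ha : a ∈ AddMonoidAlgebra.gradeBy K (height v) n) :
    fpaDecomposeAux K v a = DirectSum.of (fun n => fpaGrading K v n) n
      ⟨Ideal.Quotient.mkₐ K (rayIdeal K v) a, a, ha, rfl⟩ := by
  have hsum : a = ∑ z ∈ a.coeff.support, AddMonoidAlgebra.single z (a.coeff z) :=
    (AddMonoidAlgebra.sum_coeff_single a).symm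
  have key : ∀ z ∈ a.coeff.support,
      fpaDecomposeAux K v (AddMonoidAlgebra.single z (a.coeff z)) =
        DirectSum.lof K ℕ (fun n => fpaGrading K v n) n
          (if h : height v z = n then
            a.coeff z • ⟨fpaBasisClass K v z, h ▸ fpaBasisClass_mem K v z⟩ else 0) := by
    intro z hz
    obtain rfl := ha z hz
    rw [fpaDecomposeAux_single, dif_pos rfl, map_smul]
    rfl
  conv_lhs => rw [hsum, map_sum, Finset.sum_congr rfl key, ← map_sum]
  change DirectSum.of _ n _ = _
  congr 1
  refine Subtype.ext ?_
  conv_rhs => change Ideal.Quotient.mkₐ K (rayIdeal K v) a; rw [hsum, map_sum]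
  rw [AddSubmonoidClass.coe_finsetSum]
  refine Finset.sum_congr rfl fun z hz => ?_
  rw [dif_pos (ha z hz)]
  change a.coeff z • fpaBasisClass K v z = _
  rw [fpaBasisClass, ← map_smul, AddMonoidAlgebra.smul_single, smul_eq_mul, mul_one]

def fpaDecompose (v : Fin (d + 1) → Fin d → ℤ) : FPA K v →ₐ[K] ⨁ n, fpaGrading K v n :=
  Ideal.Quotient.liftₐ (rayIdeal K v) (fpaDecomposeAux K v) (by
    suffices h : rayIdeal K v ≤ RingHom.ker (fpaDecomposeAux K v) from fun a ha => h ha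
    refine Ideal.span_le.2 ?_
    rintro _ ⟨i, rfl⟩
    rw [SetLike.mem_coe, RingHom.mem_ker, fpaDecomposeAux_single, one_smul]
    have h0 : (⟨fpaBasisClass K v (rayGenerator v i), fpaBasisClass_mem K v _⟩ :
        fpaGrading K v (height v (rayGenerator v i))) = 0 :=
      Subtype.ext (Ideal.Quotient.eq_zero_iff_mem.2 (Ideal.subset_span ⟨i, rfl⟩))
    rw [h0, map_zero])

/-- The heights define a grading of the fundamental parallelepiped algebra. -/
instance fpaGrading.gradedAlgebra (v : Fin (d + 1) → Fin d → ℤ) :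
    GradedAlgebra (fpaGrading K v) :=
  GradedAlgebra.ofAlgHom _ (fpaDecompose K v)
    (by
      refine Ideal.Quotient.algHom_ext _ ?_
      refine AddMonoidAlgebra.algHom_ext (fun z => ?_) (by ext)
      change DirectSum.coeAlgHom _ (fpaDecomposeAux K v (AddMonoidAlgebra.single z 1)) = _
      rw [fpaDecomposeAux_single, one_smul, DirectSum.coeAlgHom_of]
      rfl)
    (by
      rintro n ⟨_, a, ha, rfl⟩
      exact fpaDecomposeAux_of_mem K v n a ha)

end FPA

/-! ## The simplices `Δ₂^m` -/

/-- The vertices of the `(m+1)`-simplex `Δ₂^m`: the standard basis vectors of `ℝ^{m+1}`, followed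
by the point `(-2, …, -2, -2m-1)`. -/
def deltaVertices (m : ℕ) : Fin (m + 2) → Fin (m + 1) → ℤ :=
  Fin.snoc (α := fun _ => Fin (m + 1) → ℤ) (fun i : Fin (m + 1) => Pi.single i 1)
    (Fin.snoc (α := fun _ => ℤ) (fun _ : Fin m => -2) (-2 * (m : ℤ) - 1))

end

/-! ### An obstruction to linearity of the resolution -/

section LinearResolution

variable {K R B : Type*} [Field K] [CommRing R] [Algebra K R] [CommRing B] [Algebra K B]
  {𝒜 : ℕ → Submodule K R} [GradedAlgebra 𝒜]

/-! Let `z` be the class of the lattice point `w = (1, 0, …, 0, -1)`. With e_j the standard basis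
vectors, (2m+1) w is twice the sum of the (1, e_j), j ≤ m, plus (1, (-2, …, -2, -2m-1)). So `k w`
has coefficients 2k/(2m+1) and k/(2m+1). For k = m+1 the former reach 1, a ray generator splits off,
and `z ^ (m + 1) = 0` (`succ_nsmul_axisGenerator`). For k ≤ m they stay below 1, so `k w` splits in
the cone only into multiples of `w` (`eq_axisPoint_of_add_eq`). Killing all other lattice points is
therefore a graded map onto K[t]/(t^(m+1)) sending `z` to `t` (`axisAlgHom`).

A linear resolution has matrices of linear forms, which become scalar matrices times `t`. As t² ≠ 0,
consecutive scalar matrices multiply to zero. Lifting the syzygy given by `z ^ m * z = 0` through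
the second differential then forces t^m = 0, a contradiction (`not_isKoszul_of_algHom`). -/

theorem one_notMem_irrelevant [Nontrivial R] :
    (1 : R) ∉ (HomogeneousIdeal.irrelevant 𝒜).toIdeal := by
  intro h
  have h0 : GradedRing.proj 𝒜 0 (1 : R) = 0 := h
  rw [GradedRing.proj_apply, DirectSum.decompose_of_mem_same 𝒜 SetLike.GradedOne.one_mem] at h0
  exact one_ne_zero h0

theorem mem_irrelevant_of_mem_one {z : R} (hz : z ∈ 𝒜 1) :
    z ∈ (HomogeneousIdeal.irrelevant 𝒜).toIdeal := by
  change GradedRing.proj 𝒜 0 z = 0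
  rw [GradedRing.proj_apply, DirectSum.decompose_of_mem_ne 𝒜 hz one_ne_zero]

/-- If a degree-preserving map to an algebra generated by `t` sends a linear form `z` to `t`, where
`z ^ (m + 1) = 0` but `t ^ m ≠ 0` for some `m ≥ 2`, then the source is not Koszul: the relation
`z ^ (m + 1) = 0` does not follow from quadratic relations. -/
theorem not_isKoszul_of_algHom (φ : R →ₐ[K] B) {t : B} {m : ℕ} (hm : 2 ≤ m) (ht : t ^ m ≠ 0)
    (hφ : ∀ a ∈ 𝒜 1, ∃ c : K, φ a = c • t) {z : R} (hz : z ∈ 𝒜 1) (hzt : φ z = t)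
    (hz0 : z ^ (m + 1) = 0) : ¬ IsKoszul 𝒜 := by
  rintro ⟨F, -, hlin⟩
  have hR : Nontrivial R := ⟨⟨1, 0, fun h => ht <| by
    rw [← mul_one (t ^ m), ← map_one φ, h, map_zero, mul_zero]⟩⟩
  have hd : ∀ i j k, F.d i j k ∈ 𝒜 1 := fun i j k =>
    F.d_mem i j k 1 (by rw [hlin, hlin])
  choose D hD using fun i j k => hφ _ (hd i j k)
  obtain ⟨j⟩ : Nonempty (Fin (F.rank 0)) := by
    by_contra hne
    rw [not_nonempty_iff] at hne
    obtain ⟨y, hy⟩ := F.aug_surjective 1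
    have hy0 : y = 0 := Subsingleton.elim _ _
    rw [hy0, map_zero] at hy
    exact one_notMem_irrelevant (𝒜 := 𝒜) (Ideal.Quotient.eq_zero_iff_mem.1 hy.symm)
  -- `z` lies in R₊, so it annihilates the target of the augmentation.
  obtain ⟨u, hu⟩ : ∃ u, (F.d 0).mulVec u = z • (Pi.single j 1 : Fin (F.rank 0) → R) := by
    refine (F.exact_aug _).1 ?_
    rw [map_smul]
    obtain ⟨r, hr⟩ := Ideal.Quotient.mk_surjective (F.aug (Pi.single j 1))
    rw [← hr]
    exact Ideal.Quotient.eq_zero_iff_mem.2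
      (Ideal.mul_mem_right _ _ (mem_irrelevant_of_mem_one hz))
  -- `z ^ m • u` is a cycle because `z ^ (m + 1) = 0`.
  obtain ⟨v, hv⟩ : ∃ v, (F.d 1).mulVec v = z ^ m • u := by
    refine (F.exact_d 0 _).1 ?_
    rw [Matrix.mulVecLin_apply, Matrix.mulVec_smul, hu, smul_smul, ← pow_succ, hz0, zero_smul]
  -- Row `j` of the product of the differentials maps to these scalars times t², and t² ≠ 0 since m
  -- ≥ 2.
  have hdd : ∀ k, ∑ l, D 0 j l * D 1 l k = 0 := by
    intro k
    have h1 : (F.d 0).mulVec ((F.d 1).mulVec (Pi.single k 1)) = 0 :=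
      (F.exact_d 0 _).2 ⟨Pi.single k 1, rfl⟩
    have h2 := congrArg φ (congrFun h1 j)
    rw [Matrix.mulVec_single_one, Matrix.mulVec, dotProduct, Pi.zero_apply, map_zero, map_sum] at h2
    simp only [Matrix.col_apply, map_mul, hD, smul_mul_smul_comm] at h2
    rw [← Finset.sum_smul] at h2
    by_contra hne
    have h3 : t * t = 0 := (smul_eq_zero_iff_right hne).1 h2
    exact ht (by rw [← Nat.sub_add_cancel hm, pow_add, sq, h3, mul_zero])
  have hu' : t = ∑ l, D 0 j l • (t * φ (u l)) := by
    have h := congrArg φ (congrFun hu j)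
    simpa [Matrix.mulVec, dotProduct, hD, hzt] using h.symm
  have hv' : ∀ l, t ^ m * φ (u l) = ∑ k, D 1 l k • (t * φ (v k)) := by
    intro l
    have h := congrArg φ (congrFun hv l)
    simpa [Matrix.mulVec, dotProduct, hD, hzt] using h.symm
  refine ht ?_
  calc t ^ m = t ^ (m - 1) * t := by rw [← pow_succ, Nat.sub_add_cancel (by omega)]
    _ = t ^ (m - 1) * ∑ l, D 0 j l • (t * φ (u l)) := by rw [← hu']
    _ = ∑ l, D 0 j l • (t ^ m * φ (u l)) := by
      rw [Finset.mul_sum]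
      refine Finset.sum_congr rfl fun l _ => ?_
      rw [mul_smul_comm, ← mul_assoc, ← pow_succ, Nat.sub_add_cancel (by omega)]
    _ = ∑ k, (∑ l, D 0 j l * D 1 l k) • (t * φ (v k)) := by
      simp only [hv', Finset.smul_sum, Finset.sum_smul, smul_smul]
      exact Finset.sum_comm
    _ = 0 := by simp only [hdd, zero_smul, Finset.sum_const_zero]

end LinearResolution

/-! ### Lattice points on the axis through (1, 0, …, 0, -1) -/

section Delta

variable {m : ℕ}

theorem deltaVertices_last_castSucc (j : Fin m) :
    deltaVertices m (Fin.last _) j.castSucc = -2 := by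
  simp [deltaVertices]

theorem deltaVertices_last_last :
    deltaVertices m (Fin.last _) (Fin.last m) = -2 * (m : ℤ) - 1 := by
  simp [deltaVertices]

theorem deltaVertices_castSucc (i : Fin (m + 1)) :
    deltaVertices m i.castSucc = Pi.single i 1 := by
  simp [deltaVertices]

/-- Here `a`, `b`, `s` are the weights of the first m basis vectors, the last basis vector and the
remaining vertex. -/
theorem mem_latticeSemigroup_delta (z : ℤ × (Fin (m + 1) → ℤ)) :
    z ∈ latticeSemigroup (deltaVertices m) ↔
      ∃ (a : Fin m → ℝ) (b s : ℝ), (∀ j, 0 ≤ a j) ∧ 0 ≤ b ∧ 0 ≤ s ∧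
        (z.1 : ℝ) = (∑ j, a j) + b + s ∧ (∀ j : Fin m, (z.2 j.castSucc : ℝ) = a j - 2 * s) ∧
        (z.2 (Fin.last m) : ℝ) = b - (2 * m + 1) * s := by
  have key : ∀ c : Fin (m + 2) → ℝ,
      (((z.1 : ℝ), fun j => (z.2 j : ℝ)) : ℝ × (Fin (m + 1) → ℝ)) =
        ∑ i, c i • ((1 : ℝ), fun j => (deltaVertices m i j : ℝ)) ↔
      (z.1 : ℝ) = (∑ j : Fin m, c j.castSucc.castSucc) + c (Fin.last m).castSucc + c (Fin.last _) ∧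
        (∀ j : Fin m, (z.2 j.castSucc : ℝ) = c j.castSucc.castSucc - 2 * c (Fin.last _)) ∧
        (z.2 (Fin.last m) : ℝ) = c (Fin.last m).castSucc - (2 * m + 1) * c (Fin.last _) := by
    intro c
    rw [Prod.ext_iff, funext_iff, Fin.forall_fin_succ']
    simp only [Prod.fst_sum, Prod.snd_sum, Prod.smul_fst, Prod.smul_snd, Finset.sum_apply,
      Pi.smul_apply, smul_eq_mul, mul_one]
    refine and_congr ?_ (and_congr (forall_congr' fun j => ?_) ?_)
    · rw [Fin.sum_univ_castSucc, Fin.sum_univ_castSucc]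
    · rw [Fin.sum_univ_castSucc, deltaVertices_last_castSucc]
      simp only [deltaVertices_castSucc, Pi.single_apply, Int.cast_ite, Int.cast_one, Int.cast_zero,
        mul_ite, mul_one, mul_zero, Finset.sum_ite_eq, Finset.mem_univ, if_true]
      push_cast
      ring_nf
    · rw [Fin.sum_univ_castSucc, deltaVertices_last_last]
      simp only [deltaVertices_castSucc, Pi.single_apply, Int.cast_ite, Int.cast_one, Int.cast_zero,
        mul_ite, mul_one, mul_zero, Finset.sum_ite_eq, Finset.mem_univ, if_true]
      push_cast
      ring_nf
  constructor
  · rintro ⟨c, hc, h⟩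
    exact ⟨_, _, _, fun j => hc _, hc _, hc _, (key c).1 h⟩
  · rintro ⟨a, b, s, ha, hb, hs, h⟩
    refine ⟨Fin.snoc (α := fun _ => ℝ) (Fin.snoc (α := fun _ => ℝ) a b) s, ?_, (key _).2 ?_⟩
    · simp [Fin.forall_fin_succ', ha, hb, hs]
    · simpa using h

variable (m) in
/-- The multiple `k (1, 0, …, 0, -1)` of the lattice point `(1, 0, …, 0, -1)`. -/
def axisPoint (k : ℤ) : ℤ × (Fin (m + 1) → ℤ) := (k, Pi.single (Fin.last m) (-k))

theorem axisPoint_snd_last (k : ℤ) : (axisPoint m k).2 (Fin.last m) = -k :=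
  Pi.single_eq_same _ _

theorem axisPoint_snd_castSucc (k : ℤ) (j : Fin m) : (axisPoint m k).2 j.castSucc = 0 :=
  Pi.single_eq_of_ne (Fin.castSucc_lt_last j).ne _

theorem axisPoint_add (k l : ℤ) : axisPoint m (k + l) = axisPoint m k + axisPoint m l := by
  simp only [axisPoint, Prod.mk_add_mk, ← Pi.single_add, neg_add]

theorem axisPoint_mem (k : ℕ) : axisPoint m k ∈ latticeSemigroup (deltaVertices m) := by
  have hm : (0 : ℝ) < 2 * m + 1 := by positivity
  refine (mem_latticeSemigroup_delta _).2 ⟨fun _ => 2 * (k / (2 * m + 1)), 0, k / (2 * m + 1),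
    fun _ => by positivity, le_rfl, by positivity, ?_, fun j => ?_, ?_⟩
  · simp [axisPoint]
    field_simp
  · simp [axisPoint]
  · simp [axisPoint]
    field_simp

/-- The multiples `k (1, 0, …, 0, -1)` with `k ≤ m` only decompose into such multiples. -/
theorem eq_axisPoint_of_add_eq {p q : ℤ × (Fin (m + 1) → ℤ)}
    (hp : p ∈ latticeSemigroup (deltaVertices m)) (hq : q ∈ latticeSemigroup (deltaVertices m))
    {k : ℤ} (hk : k ≤ m) (h : p + q = axisPoint m k) : p = axisPoint m p.1 := by
  obtain ⟨a, b, s, ha, hb, hs, h1, h2, h3⟩ := (mem_latticeSemigroup_delta p).1 hp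
  obtain ⟨a', b', s', ha', hb', hs', h1', h2', h3'⟩ := (mem_latticeSemigroup_delta q).1 hq
  have hm : (0 : ℝ) < 2 * m + 1 := by positivity
  have e1 : (p.1 : ℝ) + q.1 = k := by exact_mod_cast congrArg Prod.fst h
  have e2 : ∀ j : Fin m, (p.2 j.castSucc : ℝ) + q.2 j.castSucc = 0 := fun j => by
    have := congrFun (congrArg Prod.snd h) j.castSucc
    rw [axisPoint_snd_castSucc] at this
    exact_mod_cast this
  have e3 : (p.2 (Fin.last m) : ℝ) + q.2 (Fin.last m) = -k := by
    have := congrFun (congrArg Prod.snd h) (Fin.last m)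
    rw [axisPoint_snd_last] at this
    exact_mod_cast this
  have ea : ∀ j, a j + a' j = 2 * (s + s') := fun j => by linarith [e2 j, h2 j, h2' j]
  have esum : ∑ j, a j + ∑ j, a' j = m * (2 * (s + s')) := by
    simp [← Finset.sum_add_distrib, ea]
  -- Add the height equation to the last-coordinate equation: the terms in `s + s'` cancel, leaving
  -- 2(b + b') = 0.
  have eb : b + b' = 0 := by nlinarith
  have hb0 : b = 0 := by linarith
  have es : (2 * m + 1) * (s + s') = k := by nlinarith
  have hkm : (k : ℝ) ≤ m := by exact_mod_cast hk
  -- 2(s + s') = 2k/(2m+1) ≤ 2m/(2m+1). Each coordinate a_j - 2s lies between -2s and 2s', hence is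
  -- an integer strictly between -1 and 1.
  have hs1 : 2 * (s + s') < 1 := by nlinarith
  have hx : ∀ j : Fin m, p.2 j.castSucc = 0 := fun j => by
    have l1 : ((-1 : ℤ) : ℝ) < p.2 j.castSucc := by
      push_cast; linarith [h2 j, ha j]
    have l2 : (p.2 j.castSucc : ℝ) < ((1 : ℤ) : ℝ) := by
      push_cast; linarith [h2 j, ea j, ha' j]
    have := Int.cast_lt.1 l1
    have := Int.cast_lt.1 l2
    omega
  have ha2 : ∀ j, a j = 2 * s := fun j => by
    have := h2 j
    rw [hx j, Int.cast_zero] at this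
    linarith
  have hl : p.2 (Fin.last m) = -p.1 := by
    have : (p.2 (Fin.last m) : ℝ) = ((-p.1 : ℤ) : ℝ) := by
      push_cast
      rw [h3, h1, hb0]
      simp [ha2]
      ring
    exact_mod_cast this
  refine Prod.ext rfl (funext fun j => ?_)
  refine Fin.lastCases ?_ (fun j => ?_) j
  · rw [hl, axisPoint_snd_last]
  · rw [hx, axisPoint_snd_castSucc]

theorem rayGenerator_ne_axisPoint (hm : 1 ≤ m) (i : Fin (m + 2)) :
    ((1, deltaVertices m i) : ℤ × (Fin (m + 1) → ℤ)) ≠ axisPoint m 1 := by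
  intro h
  replace h : deltaVertices m i = (axisPoint m 1).2 := congrArg Prod.snd h
  refine Fin.lastCases (fun h => ?_) (fun i h => ?_) i h
  · have := congrFun h (Fin.last m)
    rw [deltaVertices_last_last, axisPoint_snd_last] at this
    omega
  · have := congrFun h i
    rw [deltaVertices_castSucc, axisPoint] at this
    simp only [Pi.single_apply, if_true] at this
    split_ifs at this
    omega

/-! ### The map to the truncated polynomial ring -/

variable (K : Type*) [Field K]

/-- The truncated polynomial ring `K[t] ⧸ (t ^ (m + 1))`. -/
abbrev TruncatedPolynomial (m : ℕ) : Type _ :=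
  Polynomial K ⧸ Ideal.span {(Polynomial.X : Polynomial K) ^ (m + 1)}

/-- The class of the variable in `K[t] ⧸ (t ^ (m + 1))`. -/
noncomputable def TruncatedPolynomial.var (m : ℕ) : TruncatedPolynomial K m := Ideal.Quotient.mk _ Polynomial.X

theorem TruncatedPolynomial.var_pow_eq_zero_iff (m n : ℕ) :
    TruncatedPolynomial.var K m ^ n = 0 ↔ m < n := by
  rw [TruncatedPolynomial.var, ← map_pow, Ideal.Quotient.eq_zero_iff_mem,
    Ideal.mem_span_singleton, pow_dvd_pow_iff Polynomial.X_ne_zero Polynomial.not_isUnit_X]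
  exact Nat.succ_le_iff

open Classical in
variable (m) in
/-- The map on the semigroup with `k (1, 0, …, 0, -1) ↦ t ^ k`, all other lattice points being sent
to zero. -/
noncomputable def axisMap (p : latticeSemigroup (deltaVertices m)) : TruncatedPolynomial K m :=
  if p.1 = axisPoint m p.1.1 then TruncatedPolynomial.var K m ^ height _ p else 0

theorem axisMap_of_eq {p : latticeSemigroup (deltaVertices m)} (hp : p.1 = axisPoint m p.1.1) :
    axisMap m K p = TruncatedPolynomial.var K m ^ height _ p :=
  if_pos hp

theorem axisMap_of_ne {p : latticeSemigroup (deltaVertices m)} (hp : p.1 ≠ axisPoint m p.1.1) :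
    axisMap m K p = 0 :=
  if_neg hp

theorem axisMap_zero : axisMap m K 0 = 1 := by
  have h : (0 : ℤ × (Fin (m + 1) → ℤ)) = axisPoint m 0 := by
    rw [axisPoint, neg_zero, Pi.single_zero]; rfl
  rw [axisMap_of_eq K (p := 0) h, map_zero, pow_zero]

/-- Off-axis summands can add up to an axis point only at height above m, where the power of the
variable vanishes anyway. -/
theorem axisMap_add (p q : latticeSemigroup (deltaVertices m)) :
    axisMap m K (p + q) = axisMap m K p * axisMap m K q := by
  by_cases hpq : p.1 = axisPoint m p.1.1 ∧ q.1 = axisPoint m q.1.1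
  · rw [axisMap_of_eq K hpq.1, axisMap_of_eq K hpq.2, axisMap_of_eq, map_add, pow_add]
    rw [AddSubmonoid.coe_add, Prod.fst_add, axisPoint_add, ← hpq.1, ← hpq.2]
  · have h0 : axisMap m K p * axisMap m K q = 0 := by
      by_cases hp : p.1 = axisPoint m p.1.1
      · rw [axisMap_of_ne K fun hq => hpq ⟨hp, hq⟩, mul_zero]
      · rw [axisMap_of_ne K hp, zero_mul]
    rw [h0]
    by_cases h : (p + q).1 = axisPoint m (p + q).1.1
    · rw [axisMap_of_eq K h, TruncatedPolynomial.var_pow_eq_zero_iff]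
      by_contra! hk
      have hk' : (p + q).1.1 ≤ m := Int.toNat_le.1 hk
      exact hpq ⟨eq_axisPoint_of_add_eq p.2 q.2 hk' h,
        eq_axisPoint_of_add_eq q.2 p.2 hk' ((add_comm _ _).trans h)⟩
    · exact axisMap_of_ne K h

variable (m) in
/-- `axisMap` as a homomorphism of monoids. -/
noncomputable def axisHom :
    Multiplicative (latticeSemigroup (deltaVertices m)) →* TruncatedPolynomial K m where
  toFun p := axisMap m K p.toAdd
  map_one' := axisMap_zero K
  map_mul' p q := axisMap_add K p.toAdd q.toAdd

/-- The graded algebra map from the fundamental parallelepiped algebra onto `K[t] ⧸ (t ^ (m + 1))`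
which kills all lattice points off the axis spanned by `(1, 0, …, 0, -1)`. -/
noncomputable def axisAlgHom (hm : 1 ≤ m) : FPA K (deltaVertices m) →ₐ[K] TruncatedPolynomial K m :=
  Ideal.Quotient.liftₐ (rayIdeal K (deltaVertices m)) (AddMonoidAlgebra.lift K _ _ (axisHom m K)) (by
    suffices h : rayIdeal K (deltaVertices m) ≤
      RingHom.ker (AddMonoidAlgebra.lift K _ _ (axisHom m K)) from fun a ha => h ha
    refine Ideal.span_le.2 ?_
    rintro _ ⟨i, rfl⟩
    rw [SetLike.mem_coe, RingHom.mem_ker, AddMonoidAlgebra.lift_single, one_smul]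
    exact axisMap_of_ne K (rayGenerator_ne_axisPoint hm i))

theorem axisAlgHom_fpaBasisClass (hm : 1 ≤ m) (p : latticeSemigroup (deltaVertices m)) :
    axisAlgHom K hm (fpaBasisClass K _ p) = axisMap m K p := by
  change AddMonoidAlgebra.lift K _ _ (axisHom m K) (AddMonoidAlgebra.single p 1) = _
  rw [AddMonoidAlgebra.lift_single, one_smul]
  rfl

theorem axisAlgHom_of_mem (hm : 1 ≤ m) (n : ℕ) (a : FPA K (deltaVertices m))
    (ha : a ∈ fpaGrading K (deltaVertices m) n) :
    ∃ c : K, axisAlgHom K hm a = c • TruncatedPolynomial.var K m ^ n := by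
  obtain ⟨a, ha, rfl⟩ := ha
  suffices h : AddMonoidAlgebra.lift K _ _ (axisHom m K) a ∈
      Submodule.span K {TruncatedPolynomial.var K m ^ n} by
    obtain ⟨c, hc⟩ := Submodule.mem_span_singleton.1 h
    exact ⟨c, hc.symm⟩
  rw [← AddMonoidAlgebra.sum_coeff_single a, Finsupp.sum, map_sum]
  refine Submodule.sum_mem _ fun p hp => ?_
  rw [AddMonoidAlgebra.lift_single]
  refine Submodule.smul_mem _ _ ?_
  have hn : height _ p = n := ha p hp
  change axisMap m K p ∈ _
  by_cases h : p.1 = axisPoint m p.1.1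
  · rw [axisMap_of_eq K h, hn]
    exact Submodule.mem_span_singleton_self _
  · rw [axisMap_of_ne K h]
    exact Submodule.zero_mem _

theorem fpaBasisClass_pow {d : ℕ} (v : Fin (d + 1) → Fin d → ℤ) (z : latticeSemigroup v) (n : ℕ) :
    fpaBasisClass K v z ^ n = fpaBasisClass K v (n • z) := by
  rw [fpaBasisClass, fpaBasisClass, ← map_pow, AddMonoidAlgebra.single_pow, one_pow]

theorem fpaBasisClass_rayGenerator_add {d : ℕ} (v : Fin (d + 1) → Fin d → ℤ) (i : Fin (d + 1))
    (z : latticeSemigroup v) : fpaBasisClass K v (rayGenerator v i + z) = 0 := by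
  refine Ideal.Quotient.eq_zero_iff_mem.2 ?_
  rw [← mul_one (1 : K), ← AddMonoidAlgebra.single_mul_single]
  exact Ideal.mul_mem_right _ _ (Ideal.subset_span ⟨i, rfl⟩)

variable (m) in
/-- The lattice point `(1, 0, …, 0, -1)` of the cone. -/
def axisGenerator : latticeSemigroup (deltaVertices m) := ⟨axisPoint m 1, axisPoint_mem 1⟩

theorem succ_nsmul_axisGenerator (hm : 1 ≤ m) : ∃ p,
    (m + 1) • axisGenerator m = rayGenerator (deltaVertices m) (Fin.castSucc ⟨0, by omega⟩) + p := by
  have hm0 : (0 : ℝ) < 2 * m + 1 := by positivity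
  let i : Fin m := ⟨0, hm⟩
  refine ⟨⟨(m, Pi.single (Fin.last m) (-(m + 1 : ℤ)) - Pi.single i.castSucc 1),
    (mem_latticeSemigroup_delta _).2 ⟨fun j => 2 * ((m + 1) / (2 * m + 1)) - if j = i then 1 else 0,
      0, (m + 1) / (2 * m + 1), fun j => ?_, le_rfl, by positivity, ?_, fun j => ?_, ?_⟩⟩, ?_⟩
  -- The weight of the subtracted ray generator stays nonnegative because 2(m+1) ≥ 2m+1.
  · have : (1 : ℝ) ≤ 2 * ((m + 1) / (2 * m + 1)) := by
      rw [← mul_div_assoc, le_div_iff₀ hm0]; linarith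
    dsimp only
    split_ifs <;> linarith
  · simp
    field_simp
    ring
  · simp [Pi.single_apply, Fin.castSucc_ne_last]
  · simp [(Fin.castSucc_ne_last i).symm]
    field_simp
    ring
  · refine Subtype.ext ?_
    rw [AddSubmonoidClass.coe_nsmul, AddSubmonoid.coe_add]
    change (m + 1) • axisPoint m 1 = (1, deltaVertices m (Fin.castSucc i.castSucc)) + _
    rw [deltaVertices_castSucc]
    refine Prod.ext ?_ ?_
    · simp [axisPoint, add_comm]
    · simp [axisPoint, ← Pi.single_smul]

end Delta

theorem corollary4p3 (K : Type*) [Field K] (m : ℕ) (hm : 2 ≤ m) :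
    ¬ IsKoszul (fpaGrading K (deltaVertices m)) := by
  have h1 : 1 ≤ m := by omega
  refine not_isKoszul_of_algHom (axisAlgHom K h1) (t := TruncatedPolynomial.var K m)
    (z := fpaBasisClass K _ (axisGenerator m)) hm ?_ ?_ ?_ ?_ ?_
  · rw [Ne, TruncatedPolynomial.var_pow_eq_zero_iff]
    exact lt_irrefl m
  · simpa using axisAlgHom_of_mem K h1 1
  · exact fpaBasisClass_mem K (deltaVertices m) (axisGenerator m)
  · rw [axisAlgHom_fpaBasisClass]
    exact (axisMap_of_eq K (p := axisGenerator m) rfl).trans (pow_one _)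
  · obtain ⟨p, hp⟩ := succ_nsmul_axisGenerator h1
    rw [fpaBasisClass_pow, hp, fpaBasisClass_rayGenerator_add]
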